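/- Let $C^\omega(\mathbb R,\mathbb R)$ be the real vector space of real analytic functions $\mathbb R\to\mathbb R$, topologized as follows. Let $\mathcal H(\mathbb R\subseteq\mathbb C,\mathbb C)$ be the space of germs along $\mathbb R$ of holomorphic functions $W\to\mathbb C$, where $W$ runs through the open subsets of $\mathbb C$ containing $\mathbb R$; equip it with the locally convex inductive limit topology, i.e. the finest locally convex topology for which all the canonical maps $\mathcal H(W,\mathbb C)\to\mathcal H(\mathbb R\subseteq\mathbb C,\mathbb C)$ are continuous, where $\mathcal H(W,\mathbb C)$ carries the topology of uniform convergence on compact subsets of $W$. Then $C^\omega(\mathbb R,\mathbb R)$ is given the subspace topology from its embedding into $\mathcal H(\mathbb R\subseteq\mathbb C,\mathbb C)$ which sends a real analytic function to the germ of its holomorphic extensions. A curve $f:\mathbb R\to C^\omega(\mathbb R,\mathbb R)$ is called (scalarwise) real analytic if $\lambda\circ f:\mathbb R\to\mathbb R$ is real analytic for every continuous linear functional $\lambda:C^\omega(\mathbb R,\mathbb R)\to\mathbb R$. **Theorem.** The assignment $f\mapsto f^\wedge$, $f^\wedge(s,t):=f(s)(t)$, is a bijection from the set of real analytic curves $f:\mathbb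 R\to C^\omega(\mathbb R,\mathbb R)$ onto the set of real analytic functions $\mathbb R^2\to\mathbb R$. -/

import Mathlib

open Set Filter Topology TopologicalSpace

/-! ### Spaces of holomorphic functions and of germs of holomorphic functions -/

/-- The space `𝓗(W, ℂ)` of holomorphic functions on an open set `W ⊆ ℂ`. As a subspace of `C(W, ℂ)`
it carries the compact-open topology, i.e. the topology of uniform convergence on compact subsets
of `W`. -/
def HolFun (W : Opens ℂ) : Submodule ℂ C(W, ℂ) where
  carrier := {f | ∃ g : ℂ → ℂ, DifferentiableOn ℂ g (W : Set ℂ) ∧ ∀ z : W, g z = f z}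
  zero_mem' := ⟨0, differentiableOn_const 0, fun _ => rfl⟩
  add_mem' := by
    rintro f₁ f₂ ⟨g₁, h₁, e₁⟩ ⟨g₂, h₂, e₂⟩
    exact ⟨g₁ + g₂, h₁.add h₂, fun z => by simp [e₁ z, e₂ z]⟩
  smul_mem' := by
    rintro c f ⟨g, h, e⟩
    exact ⟨c • g, h.const_smul c, fun z => by simp [e z]⟩

/-- Germs along `A` of complex functions having a representative that is holomorphic on some open
set containing `A`. -/
def holGermSubmodule (A : Set ℂ) : Submodule ℂ (Germ (𝓝ˢ A) ℂ) where
  carrier := {φ | ∃ (W : Opens ℂ) (g : ℂ → ℂ), A ⊆ (W : Set ℂ) ∧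
    DifferentiableOn ℂ g (W : Set ℂ) ∧ (g : Germ (𝓝ˢ A) ℂ) = φ}
  zero_mem' := ⟨⊤, 0, subset_univ A, differentiableOn_const 0, rfl⟩
  add_mem' := by
    rintro _ _ ⟨W₁, g₁, hA₁, h₁, rfl⟩ ⟨W₂, g₂, hA₂, h₂, rfl⟩
    exact ⟨W₁ ⊓ W₂, g₁ + g₂, subset_inter hA₁ hA₂,
      (h₁.mono inter_subset_left).add (h₂.mono inter_subset_right), rfl⟩
  smul_mem' := by
    rintro c _ ⟨W, g, hA, h, rfl⟩
    exact ⟨W, c • g, hA, h.const_smul c, rfl⟩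

/-- The space `𝓗(A ⊆ ℂ, ℂ)` of germs along `A` of holomorphic functions. -/
def HolGerm (A : Set ℂ) : Type := holGermSubmodule A

namespace HolGerm

variable {A : Set ℂ}

noncomputable instance : AddCommGroup (HolGerm A) := inferInstanceAs (AddCommGroup (holGermSubmodule A))

noncomputable instance : Module ℂ (HolGerm A) := inferInstanceAs (Module ℂ (holGermSubmodule A))

/-- The canonical map `𝓗(W, ℂ) → 𝓗(A ⊆ ℂ, ℂ)` for open `W ⊇ A`. The extension by zero outside
`W` does not affect the germ along `A`. -/
noncomputable def ofHolFun (W : Opens ℂ) (hA : A ⊆ (W : Set ℂ)) : HolFun W →ₗ[ℂ] HolGerm A where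
  toFun f := ⟨((Function.extend Subtype.val (f : C(W, ℂ)) 0 : ℂ → ℂ) : Germ (𝓝ˢ A) ℂ), by
    obtain ⟨f, g, hg, e⟩ := f
    refine ⟨W, _, hA, hg.congr fun z hz => ?_, rfl⟩
    rw [e ⟨z, hz⟩]
    exact Subtype.val_injective.extend_apply f 0 ⟨z, hz⟩⟩
  map_add' f₁ f₂ := by
    apply Subtype.ext
    refine congrArg (fun g : ℂ → ℂ => (g : Germ (𝓝ˢ A) ℂ)) ?_
    have := Function.extend_add (Subtype.val : W → ℂ) (f₁ : C(W, ℂ)) (f₂ : C(W, ℂ))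
      (0 : ℂ → ℂ) 0
    rw [add_zero] at this
    exact this
  map_smul' c f := by
    apply Subtype.ext
    refine congrArg (fun g : ℂ → ℂ => (g : Germ (𝓝ˢ A) ℂ)) ?_
    have := Function.extend_smul c (Subtype.val : W → ℂ) (f : C(W, ℂ)) (0 : ℂ → ℂ)
    rw [smul_zero] at this
    exact this

/-- The locally convex inductive limit topology on `𝓗(A ⊆ ℂ, ℂ)`: the finest locally convex
vector space topology for which all the maps `𝓗(W, ℂ) → 𝓗(A ⊆ ℂ, ℂ)`, `W ⊇ A` open, are
continuous. (In Mathlib's order on topologies the finest topology is the infimum.) -/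
noncomputable instance : TopologicalSpace (HolGerm A) :=
  sInf {t : TopologicalSpace (HolGerm A) |
    @IsTopologicalAddGroup (HolGerm A) t _ ∧ @ContinuousSMul ℂ (HolGerm A) _ _ t ∧
    @LocallyConvexSpace ℝ (HolGerm A) _ _ _ _ t ∧
    ∀ (W : Opens ℂ) (hA : A ⊆ (W : Set ℂ)), Continuous[inferInstance, t] (ofHolFun W hA)}

end HolGerm

/-! ### The space of real analytic functions `ℝ → ℝ` -/

/-- The real axis in `ℂ`. -/
def realAxis : Set ℂ := range ((↑) : ℝ → ℂ)

/-- Local holomorphic extension of a real analytic function. -/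
theorem exists_local_holomorphic_extension {f : ℝ → ℝ} {x : ℝ} (hf : AnalyticAt ℝ f x) :
    ∃ r > 0, ∃ g : ℂ → ℂ, DifferentiableOn ℂ g (Metric.ball (x : ℂ) r) ∧
      ∀ y : ℝ, (y : ℂ) ∈ Metric.ball (x : ℂ) r → g y = f y := by
  obtain ⟨p, r, hp⟩ := hf
  set q : FormalMultilinearSeries ℂ ℂ ℂ :=
    FormalMultilinearSeries.ofScalars ℂ (fun n => ((p.coeff n : ℝ) : ℂ)) with hq
  have hnorm : ∀ n, ‖q n‖ = ‖p n‖ := fun n => by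
    rw [hq, FormalMultilinearSeries.ofScalars_norm, Complex.norm_real,
      FormalMultilinearSeries.norm_apply_eq_norm_coef]
  have hrad : p.radius ≤ q.radius :=
    FormalMultilinearSeries.radius_le_of_le (fun n => (hnorm n).le)
  have hqpos : 0 < q.radius := lt_of_lt_of_le (hp.r_pos.trans_le hp.r_le) hrad
  have hqb := q.hasFPowerSeriesOnBall hqpos
  obtain ⟨s, hs0, hsr⟩ := ENNReal.lt_iff_exists_nnreal_btwn.1 hp.r_pos
  have hs0' : 0 < (s : ℝ) := by exact_mod_cast hs0
  refine ⟨s, hs0', fun z => q.sum (z - x), ?_, ?_⟩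
  · refine hqb.differentiableOn.comp (differentiableOn_id.sub_const _) ?_
    intro z hz
    rw [Metric.mem_ball, dist_eq_norm] at hz
    rw [Metric.mem_eball, edist_zero_right]
    refine lt_of_lt_of_le ?_ ((hsr.le.trans hp.r_le).trans hrad)
    rw [← ofReal_norm, ← ENNReal.ofReal_coe_nnreal]
    exact (ENNReal.ofReal_lt_ofReal_iff hs0').2 hz
  · intro y hy
    rw [Metric.mem_ball, dist_eq_norm, ← Complex.ofReal_sub, Complex.norm_real] at hy
    have hmem : (y - x : ℝ) ∈ Metric.eball (0 : ℝ) r := by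
      rw [Metric.mem_eball, edist_zero_right]
      refine lt_of_lt_of_le ?_ hsr.le
      rw [← ofReal_norm, ← ENNReal.ofReal_coe_nnreal]
      exact (ENNReal.ofReal_lt_ofReal_iff hs0').2 hy
    have hsum := hp.hasSum hmem
    rw [add_sub_cancel] at hsum
    have hsumC := Complex.hasSum_ofReal.2 hsum
    change ∑' n, q n (fun _ => (y : ℂ) - x) = f y
    rw [← hsumC.tsum_eq]
    refine tsum_congr fun n => ?_
    rw [hq, FormalMultilinearSeries.ofScalars_apply_eq,
      FormalMultilinearSeries.apply_eq_pow_smul_coeff]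
    simp [mul_comm]

/-- Two holomorphic functions on a ball with real center which agree at the real points of the
intersection with another such ball agree on the intersection. -/
theorem eqOn_inter_ball_of_eq_real {x y r s : ℝ} {g h : ℂ → ℂ}
    (hg : DifferentiableOn ℂ g (Metric.ball (x : ℂ) r))
    (hh : DifferentiableOn ℂ h (Metric.ball (y : ℂ) s))
    (heq : ∀ t : ℝ, (t : ℂ) ∈ Metric.ball (x : ℂ) r → (t : ℂ) ∈ Metric.ball (y : ℂ) s →
      g t = h t) :
    EqOn g h (Metric.ball (x : ℂ) r ∩ Metric.ball (y : ℂ) s) := by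
  intro z hz
  have hopen : IsOpen (Metric.ball (x : ℂ) r ∩ Metric.ball (y : ℂ) s) :=
    Metric.isOpen_ball.inter Metric.isOpen_ball
  have hball : ∀ (a ρ : ℝ), z ∈ Metric.ball (a : ℂ) ρ → ((z.re : ℝ) : ℂ) ∈ Metric.ball (a : ℂ) ρ := by
    intro a ρ hz
    rw [Metric.mem_ball, dist_eq_norm] at hz ⊢
    rw [← Complex.ofReal_sub, Complex.norm_real]
    refine lt_of_le_of_lt ?_ hz
    simpa using Complex.abs_re_le_norm (z - a)
  have hmem : ((z.re : ℝ) : ℂ) ∈ Metric.ball (x : ℂ) r ∩ Metric.ball (y : ℂ) s :=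
    ⟨hball x r hz.1, hball y s hz.2⟩
  have hpre : IsPreconnected (Metric.ball (x : ℂ) r ∩ Metric.ball (y : ℂ) s) :=
    ((convex_ball _ _).inter (convex_ball _ _)).isPreconnected
  refine ((hg.mono inter_subset_left).analyticOnNhd hopen).eqOn_of_preconnected_of_frequently_eq
    ((hh.mono inter_subset_right).analyticOnNhd hopen) hpre hmem ?_ hz
  have htend : Tendsto ((↑) : ℝ → ℂ) (𝓝[≠] z.re) (𝓝[≠] ((z.re : ℝ) : ℂ)) := by
    refine tendsto_nhdsWithin_iff.2 ⟨Complex.continuous_ofReal.continuousAt.mono_left inf_le_left, ?_⟩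
    filter_upwards [self_mem_nhdsWithin] with t ht
    simpa using ht
  refine htend.frequently (Eventually.frequently ?_)
  have : ∀ᶠ t : ℝ in 𝓝 z.re, (t : ℂ) ∈ Metric.ball (x : ℂ) r ∩ Metric.ball (y : ℂ) s :=
    Complex.continuous_ofReal.continuousAt.eventually (hopen.mem_nhds hmem)
  filter_upwards [this.filter_mono inf_le_left] with t ht using heq t ht.1 ht.2

/-- Every real analytic function on `ℝ` extends to a holomorphic function on an open neighbourhood
of the real axis. -/
theorem exists_holomorphic_extension {f : ℝ → ℝ} (hf : AnalyticOnNhd ℝ f univ) :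
    ∃ (W : Opens ℂ) (g : ℂ → ℂ), realAxis ⊆ (W : Set ℂ) ∧ DifferentiableOn ℂ g (W : Set ℂ) ∧
      ∀ x : ℝ, g x = f x := by
  choose r hr g hg hgf using fun x : ℝ => exists_local_holomorphic_extension (hf x (mem_univ x))
  classical
  let G : ℂ → ℂ := fun z =>
    if h : ∃ x : ℝ, z ∈ Metric.ball (x : ℂ) (r x) then g h.choose z else 0
  have hG : ∀ x : ℝ, EqOn G (g x) (Metric.ball (x : ℂ) (r x)) := by
    intro x z hz
    have h : ∃ x : ℝ, z ∈ Metric.ball (x : ℂ) (r x) := ⟨x, hz⟩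
    simp only [G, dif_pos h]
    exact eqOn_inter_ball_of_eq_real (hg _) (hg x)
      (fun t h₁ h₂ => (hgf _ t h₁).trans (hgf x t h₂).symm) ⟨h.choose_spec, hz⟩
  refine ⟨⟨⋃ x : ℝ, Metric.ball (x : ℂ) (r x), isOpen_iUnion fun _ => Metric.isOpen_ball⟩, G,
    ?_, ?_, ?_⟩
  · rintro _ ⟨x, rfl⟩
    exact mem_iUnion.2 ⟨x, Metric.mem_ball_self (hr x)⟩
  · intro z hz
    obtain ⟨x, hx⟩ := mem_iUnion.1 hz
    have hnhds := Metric.isOpen_ball.mem_nhds hx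
    exact (((hg x).differentiableAt hnhds).congr_of_eventuallyEq
      ((hG x).eventuallyEq_of_mem hnhds)).differentiableWithinAt
  · intro x
    rw [hG x (Metric.mem_ball_self (hr x)), hgf x x (Metric.mem_ball_self (hr x))]

/-- A holomorphic germ along the real axis is determined by its values on the real axis. -/
theorem germ_eq_of_eq_real {W₁ W₂ : Opens ℂ} {g₁ g₂ : ℂ → ℂ}
    (hW₁ : realAxis ⊆ (W₁ : Set ℂ)) (hW₂ : realAxis ⊆ (W₂ : Set ℂ))
    (h₁ : DifferentiableOn ℂ g₁ (W₁ : Set ℂ)) (h₂ : DifferentiableOn ℂ g₂ (W₂ : Set ℂ))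
    (heq : ∀ x : ℝ, g₁ x = g₂ x) :
    (g₁ : Germ (𝓝ˢ realAxis) ℂ) = (g₂ : Germ (𝓝ˢ realAxis) ℂ) := by
  refine Germ.coe_eq.2 (eventually_nhdsSet_iff_forall.2 ?_)
  rintro _ ⟨x, rfl⟩
  have hx : (x : ℂ) ∈ realAxis := ⟨x, rfl⟩
  have ho := (W₁.isOpen.inter W₂.isOpen).mem_nhds ⟨hW₁ hx, hW₂ hx⟩
  obtain ⟨ε, hε, hb⟩ := Metric.mem_nhds_iff.1 ho
  have := eqOn_inter_ball_of_eq_real (x := x) (y := x) (r := ε) (s := ε)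
    (h₁.mono (hb.trans inter_subset_left)) (h₂.mono (hb.trans inter_subset_right))
    (fun t _ _ => heq t)
  rw [inter_self] at this
  exact this.eventuallyEq_of_mem (Metric.ball_mem_nhds _ hε)

/-- The real analytic functions `ℝ → ℝ`. -/
def realAnalyticSubmodule : Submodule ℝ (ℝ → ℝ) where
  carrier := {f | AnalyticOnNhd ℝ f univ}
  zero_mem' := analyticOnNhd_const
  add_mem' hf hg := hf.add hg
  smul_mem' c _ hf := fun x hx => (hf x hx).const_smul (c := c)

/-- The space `C^ω(ℝ, ℝ)` of real analytic functions `ℝ → ℝ`. -/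
def RealAnalyticFun : Type := realAnalyticSubmodule

namespace RealAnalyticFun

instance : AddCommGroup RealAnalyticFun := inferInstanceAs (AddCommGroup realAnalyticSubmodule)

noncomputable instance : Module ℝ RealAnalyticFun :=
  inferInstanceAs (Module ℝ realAnalyticSubmodule)

instance : FunLike RealAnalyticFun ℝ ℝ where
  coe f := f.1
  coe_injective := Subtype.coe_injective

theorem analytic (f : RealAnalyticFun) : AnalyticOnNhd ℝ f univ := f.2

/-- The germ along the real axis of a holomorphic extension of `f`. -/
noncomputable def extensionGerm (f : RealAnalyticFun) : HolGerm realAxis :=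
  ⟨((exists_holomorphic_extension f.analytic).choose_spec.choose : ℂ → ℂ),
    (exists_holomorphic_extension f.analytic).choose, _,
    (exists_holomorphic_extension f.analytic).choose_spec.choose_spec.1,
    (exists_holomorphic_extension f.analytic).choose_spec.choose_spec.2.1, rfl⟩

/-- `extensionGerm f` is the germ of any holomorphic extension of `f`. -/
theorem extensionGerm_val_eq (f : RealAnalyticFun) {W : Opens ℂ} {g : ℂ → ℂ}
    (hW : realAxis ⊆ (W : Set ℂ)) (hg : DifferentiableOn ℂ g (W : Set ℂ))
    (hgf : ∀ x : ℝ, g x = f x) :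
    (extensionGerm f).1 = (g : Germ (𝓝ˢ realAxis) ℂ) := by
  obtain ⟨h₁, h₂, h₃⟩ := (exists_holomorphic_extension f.analytic).choose_spec.choose_spec
  exact germ_eq_of_eq_real h₁ hW h₂ hg fun x => (h₃ x).trans (hgf x).symm

/-- The embedding of `C^ω(ℝ, ℝ)` into `𝓗(ℝ ⊆ ℂ, ℂ)` as the germs which are real on `ℝ`. -/
noncomputable def toHolGerm : RealAnalyticFun →ₗ[ℝ] HolGerm realAxis where
  toFun := extensionGerm
  map_add' f₁ f₂ := by
    obtain ⟨W₁, g₁, hW₁, h₁, e₁⟩ := exists_holomorphic_extension f₁.analytic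
    obtain ⟨W₂, g₂, hW₂, h₂, e₂⟩ := exists_holomorphic_extension f₂.analytic
    apply Subtype.ext
    have hadd : ((extensionGerm f₁ + extensionGerm f₂ : HolGerm realAxis)).1 =
      (extensionGerm f₁).1 + (extensionGerm f₂).1 := rfl
    rw [hadd, extensionGerm_val_eq f₁ hW₁ h₁ e₁, extensionGerm_val_eq f₂ hW₂ h₂ e₂]
    refine extensionGerm_val_eq (W := W₁ ⊓ W₂) (g := g₁ + g₂) _ (subset_inter hW₁ hW₂)
      ((h₁.mono inter_subset_left).add (h₂.mono inter_subset_right)) fun x => ?_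
    have : (f₁ + f₂ : RealAnalyticFun) x = f₁ x + f₂ x := rfl
    simp [e₁, e₂, this]
  map_smul' c f := by
    obtain ⟨W, g, hW, h, e⟩ := exists_holomorphic_extension f.analytic
    apply Subtype.ext
    have hsmul : ((RingHom.id ℝ c • extensionGerm f : HolGerm realAxis)).1 =
      (c : ℂ) • (extensionGerm f).1 := rfl
    rw [hsmul, extensionGerm_val_eq f hW h e]
    refine extensionGerm_val_eq (W := W) (g := (c : ℂ) • g) _ hW (h.const_smul _) fun x => ?_
    have : (c • f : RealAnalyticFun) x = c * f x := rfl
    simp [e, this]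

/-- `C^ω(ℝ, ℝ)` is topologized as the real part, hence as a subspace, of `𝓗(ℝ ⊆ ℂ, ℂ)`. -/
noncomputable instance : TopologicalSpace RealAnalyticFun :=
  TopologicalSpace.induced toHolGerm inferInstance

end RealAnalyticFun

/-! ### Real analytic curves -/

/-- A curve `c : ℝ → E` is (scalarwise) real analytic if its composite with every continuous linear
functional on `E` is a real analytic function. -/
def IsRealAnalyticCurve {E : Type*} [AddCommGroup E] [Module ℝ E] [TopologicalSpace E]
    (c : ℝ → E) : Prop :=
  ∀ l : E →L[ℝ] ℝ, AnalyticOnNhd ℝ (fun t => l (c t)) univ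

/-! ### Holomorphic extension of real analytic functions of two variables -/

/-! Injectivity is immediate; the content is that scalarwise analyticity of `f` and joint
analyticity of `f^` are equivalent.

Let `g` be jointly analytic. It extends to a holomorphic `G` near `ℝ²` in `ℂ²`. For `s` in a compact
real interval, all `G(s, ·)` live on one open `W ⊇ ℝ`. A continuous functional, pulled back to
holomorphic functions on `W`, extends by Hahn–Banach to `C(K, ℂ)` for some compact `K ⊆ W`
(`exists_extension_compact`), and `s ↦ G(s, ·)` is a holomorphic curve in `C(K, ℂ)` by Cauchy's
formula (`analyticAt_curry`).

Conversely, let `f` be scalarwise analytic, and let `Aₙ(s)` be the Taylor coefficients of `f(s)` at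
`t₀`. If `μ` decreases faster than every geometric sequence, then `∑ μₙ Aₙ` comes from a continuous
functional and is analytic in `s`. A fixed positive weight of this kind yields a scalarwise analytic
family of functionals on `ℓ^∞`, whose Taylor coefficients are uniformly bounded by Banach–Steinhaus
and Baire (`exists_iteratedDeriv_bound_of_dual`). As every such weight is allowed, a diagonal
argument (`exists_bound_of_weighted_bound`) bounds the double Taylor coefficients by `C k^(m+n)`,
which forces joint analyticity (`analyticAt_prod_of_iteratedDeriv_bound`). -/

/-- The complexification of a real power series in two variables. -/
noncomputable def complexifySeries (p : FormalMultilinearSeries ℝ (ℝ × ℝ) ℝ) :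
    FormalMultilinearSeries ℂ (ℂ × ℂ) ℂ := fun n =>
  ∑ A : Finset (Fin n),
    ((p n (A.piecewise (fun _ => ((1 : ℝ), (0 : ℝ))) fun _ => ((0 : ℝ), (1 : ℝ))) : ℝ) : ℂ) •
      (ContinuousMultilinearMap.mkPiAlgebra ℂ (Fin n) ℂ).compContinuousLinearMap
        (fun i => if i ∈ A then ContinuousLinearMap.fst ℂ ℂ ℂ else ContinuousLinearMap.snd ℂ ℂ ℂ)

/-- There are `2 ^ n` subsets `A`, and each summand has norm at most `‖p n‖`. -/
theorem norm_complexifySeries_le (p : FormalMultilinearSeries ℝ (ℝ × ℝ) ℝ) (n : ℕ) :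
    ‖complexifySeries p n‖ ≤ 2 ^ n * ‖p n‖ := by
  have key : ∀ A ∈ (Finset.univ : Finset (Finset (Fin n))),
      ‖((p n (A.piecewise (fun _ => ((1 : ℝ), (0 : ℝ))) fun _ => ((0 : ℝ), (1 : ℝ))) : ℝ) : ℂ) •
      (ContinuousMultilinearMap.mkPiAlgebra ℂ (Fin n) ℂ).compContinuousLinearMap
        (fun i => if i ∈ A then ContinuousLinearMap.fst ℂ ℂ ℂ
          else ContinuousLinearMap.snd ℂ ℂ ℂ)‖ ≤ ‖p n‖ := by
    intro A _
    have h₁ : ‖p n (A.piecewise (fun _ => ((1 : ℝ), (0 : ℝ))) fun _ => ((0 : ℝ), (1 : ℝ)))‖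
        ≤ ‖p n‖ := by
      refine ((p n).le_opNorm _).trans (mul_le_of_le_one_right (norm_nonneg _)
        (Finset.prod_le_one (fun _ _ => norm_nonneg _) fun i _ => ?_))
      by_cases hi : i ∈ A <;> simp [hi, Prod.norm_def]
    have h₂ : ‖(ContinuousMultilinearMap.mkPiAlgebra ℂ (Fin n) ℂ).compContinuousLinearMap
        (fun i => if i ∈ A then ContinuousLinearMap.fst ℂ ℂ ℂ
          else ContinuousLinearMap.snd ℂ ℂ ℂ)‖ ≤ 1 := by
      refine (ContinuousMultilinearMap.norm_compContinuousLinearMap_le _ _).trans ?_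
      rw [ContinuousMultilinearMap.norm_mkPiAlgebra, one_mul]
      refine Finset.prod_le_one (fun _ _ => norm_nonneg _) fun i _ => ?_
      split_ifs
      · exact ContinuousLinearMap.norm_fst_le ..
      · exact ContinuousLinearMap.norm_snd_le ..
    rw [norm_smul, Complex.norm_real]
    exact (mul_le_of_le_one_right (norm_nonneg _) h₂).trans h₁
  refine (norm_sum_le_of_le _ key).trans ?_
  simp

/-- Multilinear expansion of `(s, t) = (s, 0) + (0, t)`: `A` is the set of slots receiving the first
coordinate. -/
theorem complexifySeries_ofReal (p : FormalMultilinearSeries ℝ (ℝ × ℝ) ℝ) (n : ℕ) (s t : ℝ) :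
    complexifySeries p n (fun _ => ((s : ℂ), (t : ℂ))) = (p n (fun _ => (s, t)) : ℝ) := by
  have h : (fun _ : Fin n => (s, t)) = (fun _ => (s, (0 : ℝ))) + fun _ => ((0 : ℝ), t) := by
    ext <;> simp
  rw [h, ContinuousMultilinearMap.map_add_univ]
  simp only [complexifySeries, _root_.sum_apply,
    _root_.smul_apply, Complex.ofReal_sum]
  refine Finset.sum_congr rfl fun A _ => ?_
  have hA : (A.piecewise (fun _ : Fin n => (s, (0 : ℝ))) fun _ => ((0 : ℝ), t)) =
      fun i => (if i ∈ A then s else t) •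
        A.piecewise (fun _ : Fin n => ((1 : ℝ), (0 : ℝ))) (fun _ => ((0 : ℝ), (1 : ℝ))) i := by
    ext i <;> by_cases hi : i ∈ A <;> simp [hi]
  rw [hA, ContinuousMultilinearMap.map_smul_univ]
  simp only [ContinuousMultilinearMap.compContinuousLinearMap_apply,
    ContinuousMultilinearMap.mkPiAlgebra_apply, smul_eq_mul, Complex.ofReal_mul,
    Complex.ofReal_prod]
  rw [mul_comm]
  congr 1
  refine Finset.prod_congr rfl fun i _ => ?_
  by_cases hi : i ∈ A <;> simp [hi]

theorem norm_sub_ofReal_prod (a b : ℝ × ℝ) :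
    ‖((a.1 : ℂ), (a.2 : ℂ)) - ((b.1 : ℂ), (b.2 : ℂ))‖ = ‖a - b‖ := by
  simp only [Prod.norm_def, Prod.mk_sub_mk, ← Complex.ofReal_sub, Complex.norm_real,
    Prod.fst_sub, Prod.snd_sub]

theorem exists_local_holomorphic_extension_prod {f : ℝ × ℝ → ℝ} {x : ℝ × ℝ}
    (hf : AnalyticAt ℝ f x) :
    ∃ r > 0, ∃ G : ℂ × ℂ → ℂ, DifferentiableOn ℂ G (Metric.ball ((x.1 : ℂ), (x.2 : ℂ)) r) ∧
      ∀ y : ℝ × ℝ, ((y.1 : ℂ), (y.2 : ℂ)) ∈ Metric.ball ((x.1 : ℂ), (x.2 : ℂ)) r →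
        G (y.1, y.2) = f y := by
  obtain ⟨p, r, hp⟩ := hf
  set q := complexifySeries p with hq
  obtain ⟨s, hs0, hsr⟩ := ENNReal.lt_iff_exists_nnreal_btwn.1 hp.r_pos
  have hs0' : (0 : ℝ) < s := by exact_mod_cast hs0
  obtain ⟨C, -, hC⟩ := p.norm_mul_pow_le_of_lt_radius (hsr.trans_le hp.r_le)
  -- Halving the radius absorbs the factor `2 ^ n` lost in complexification.
  have hrad : ((s / 2 : NNReal) : ENNReal) ≤ q.radius := by
    refine q.le_radius_of_bound C fun n => le_trans ?_ (hC n)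
    calc ‖q n‖ * ((s / 2 : NNReal) : ℝ) ^ n ≤ 2 ^ n * ‖p n‖ * ((s / 2 : NNReal) : ℝ) ^ n := by
          gcongr; exact norm_complexifySeries_le p n
      _ = ‖p n‖ * (s : ℝ) ^ n := by
          rw [mul_comm (2 ^ n) ‖p n‖, mul_assoc, ← mul_pow]; push_cast; ring_nf
  have hhalf : (0 : ENNReal) < ((s / 2 : NNReal) : ENNReal) := by
    exact_mod_cast half_pos hs0'
  have hqb := q.hasFPowerSeriesOnBall (hhalf.trans_le hrad)
  refine ⟨(s / 2 : NNReal), by exact_mod_cast hhalf,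
    fun z => q.sum (z - ((x.1 : ℂ), (x.2 : ℂ))), ?_, ?_⟩
  · refine hqb.differentiableOn.comp (differentiableOn_id.sub_const _) ?_
    intro z hz
    rw [← Metric.eball_coe, Metric.mem_eball, edist_eq_enorm_sub] at hz
    rw [Metric.mem_eball, edist_zero_right]
    exact hz.trans_le hrad
  · intro y hy
    rw [Metric.mem_ball, dist_eq_norm, norm_sub_ofReal_prod, ← dist_eq_norm, ← Metric.mem_ball,
      ← Metric.eball_coe, Metric.mem_eball, edist_eq_enorm_sub] at hy
    have hmem : y - x ∈ Metric.eball (0 : ℝ × ℝ) r := by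
      rw [Metric.mem_eball, edist_zero_right]
      refine hy.trans (lt_of_le_of_lt ?_ hsr)
      exact_mod_cast half_le_self hs0'.le
    have hsum := hp.hasSum hmem
    rw [add_sub_cancel] at hsum
    rw [← (Complex.hasSum_ofReal.2 hsum).tsum_eq]
    change ∑' n, q n (fun _ => ((y.1 : ℂ), (y.2 : ℂ)) - ((x.1 : ℂ), (x.2 : ℂ))) = _
    refine tsum_congr fun n => ?_
    rw [Prod.mk_sub_mk, ← Complex.ofReal_sub, ← Complex.ofReal_sub, hq, complexifySeries_ofReal]
    rfl

/-- Holomorphic functions on two polydiscs with real centers which agree at the real points of the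
intersection agree on the intersection. -/
theorem eqOn_inter_ball_prod_of_eq_real {x y : ℝ × ℝ} {r s : ℝ} {g h : ℂ × ℂ → ℂ}
    (hg : DifferentiableOn ℂ g (Metric.ball ((x.1 : ℂ), (x.2 : ℂ)) r))
    (hh : DifferentiableOn ℂ h (Metric.ball ((y.1 : ℂ), (y.2 : ℂ)) s))
    (heq : ∀ t : ℝ × ℝ, ((t.1 : ℂ), (t.2 : ℂ)) ∈ Metric.ball ((x.1 : ℂ), (x.2 : ℂ)) r →
      ((t.1 : ℂ), (t.2 : ℂ)) ∈ Metric.ball ((y.1 : ℂ), (y.2 : ℂ)) s → g (t.1, t.2) = h (t.1, t.2)) :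
    EqOn g h (Metric.ball ((x.1 : ℂ), (x.2 : ℂ)) r ∩ Metric.ball ((y.1 : ℂ), (y.2 : ℂ)) s) := by
  rintro ⟨z, w⟩ ⟨hzx, hzy⟩
  rw [← ball_prod_same] at hg hh hzx hzy
  simp only [← ball_prod_same, mem_prod] at heq
  obtain ⟨hz₁, hw₁⟩ := hzx
  obtain ⟨hz₂, hw₂⟩ := hzy
  -- One variable at a time: with `w` complex it suffices to treat real `a`, and for real `a` it
  -- suffices to treat real `b`.
  refine eqOn_inter_ball_of_eq_real (g := fun a => g (a, w)) (h := fun a => h (a, w))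
    (hg.comp (by fun_prop) fun a ha => ⟨ha, hw₁⟩)
    (hh.comp (by fun_prop) fun a ha => ⟨ha, hw₂⟩) (fun a ha₁ ha₂ => ?_) ⟨hz₁, hz₂⟩
  exact eqOn_inter_ball_of_eq_real (g := fun b => g (a, b)) (h := fun b => h (a, b))
    (hg.comp (by fun_prop) fun b hb => ⟨ha₁, hb⟩)
    (hh.comp (by fun_prop) fun b hb => ⟨ha₂, hb⟩)
    (fun b hb₁ hb₂ => heq (a, b) ⟨ha₁, hb₁⟩ ⟨ha₂, hb₂⟩) ⟨hw₁, hw₂⟩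

/-- Every real analytic function on `ℝ²` extends to a holomorphic function on an open neighbourhood
of `ℝ²` in `ℂ²`. -/
theorem exists_holomorphic_extension_prod {f : ℝ × ℝ → ℝ} (hf : AnalyticOnNhd ℝ f univ) :
    ∃ (Ω : Set (ℂ × ℂ)) (G : ℂ × ℂ → ℂ), IsOpen Ω ∧ (∀ s t : ℝ, ((s : ℂ), (t : ℂ)) ∈ Ω) ∧
      DifferentiableOn ℂ G Ω ∧ ∀ s t : ℝ, G (s, t) = f (s, t) := by
  choose r hr g hg hgf using fun x : ℝ × ℝ =>
    exists_local_holomorphic_extension_prod (hf x (mem_univ x))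
  classical
  let G : ℂ × ℂ → ℂ := fun z =>
    if h : ∃ x : ℝ × ℝ, z ∈ Metric.ball ((x.1 : ℂ), (x.2 : ℂ)) (r x) then g h.choose z else 0
  have hG : ∀ x : ℝ × ℝ, EqOn G (g x) (Metric.ball ((x.1 : ℂ), (x.2 : ℂ)) (r x)) := by
    intro x z hz
    have h : ∃ x : ℝ × ℝ, z ∈ Metric.ball ((x.1 : ℂ), (x.2 : ℂ)) (r x) := ⟨x, hz⟩
    simp only [G, dif_pos h]
    exact eqOn_inter_ball_prod_of_eq_real (hg _) (hg x)
      (fun t h₁ h₂ => (hgf _ t h₁).trans (hgf x t h₂).symm) ⟨h.choose_spec, hz⟩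
  refine ⟨⋃ x : ℝ × ℝ, Metric.ball ((x.1 : ℂ), (x.2 : ℂ)) (r x), G,
    isOpen_iUnion fun _ => Metric.isOpen_ball, ?_, ?_, ?_⟩
  · exact fun s t => mem_iUnion.2 ⟨(s, t), Metric.mem_ball_self (hr _)⟩
  · intro z hz
    obtain ⟨x, hx⟩ := mem_iUnion.1 hz
    have hnhds := Metric.isOpen_ball.mem_nhds hx
    exact (((hg x).differentiableAt hnhds).congr_of_eventuallyEq
      ((hG x).eventuallyEq_of_mem hnhds)).differentiableWithinAt
  · intro s t
    have h := Metric.mem_ball_self (x := ((s : ℂ), (t : ℂ))) (hr (s, t))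
    exact (hG (s, t) h).trans (hgf (s, t) (s, t) h)

/-! ### Analyticity of the curves associated with analytic functions of two variables -/

theorem AnalyticAt.re_comp_ofReal {g : ℂ → ℂ} {x : ℝ} (hg : AnalyticAt ℂ g x) :
    AnalyticAt ℝ (fun t : ℝ => (g t).re) x :=
  (Complex.reCLM.analyticAt _).comp
    ((hg.restrictScalars (𝕜 := ℝ)).comp_of_eq (Complex.ofRealCLM.analyticAt x) rfl)

/-- The holomorphic functions on `W` that are real on the real axis. -/
def realHolFun (W : Opens ℂ) : Submodule ℝ C(W, ℂ) where
  carrier := {F | F ∈ HolFun W ∧ ∀ (x : ℝ) (hx : (x : ℂ) ∈ W), (F ⟨x, hx⟩).im = 0}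
  zero_mem' := ⟨(HolFun W).zero_mem, fun _ _ => rfl⟩
  add_mem' h₁ h₂ := ⟨(HolFun W).add_mem h₁.1 h₂.1, fun x hx => by simp [h₁.2 x hx, h₂.2 x hx]⟩
  smul_mem' c F h := ⟨(HolFun W).smul_mem (c : ℂ) h.1, fun x hx => by simp [h.2 x hx]⟩

/-- The restriction of a holomorphic function that is real on the real axis to the real axis. -/
noncomputable def realHolFun.toRealAnalyticFun (W : Opens ℂ) (hW : realAxis ⊆ (W : Set ℂ)) :
    realHolFun W →ₗ[ℝ] RealAnalyticFun where
  toFun F := ⟨fun x => (F.1 ⟨x, hW ⟨x, rfl⟩⟩).re, by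
    obtain ⟨g, hg, e⟩ := F.2.1
    intro x _
    have h := ((hg.analyticOnNhd W.isOpen) x (hW ⟨x, rfl⟩)).re_comp_ofReal
    exact h.congr (Eventually.of_forall fun t => congrArg Complex.re (e ⟨t, hW ⟨t, rfl⟩⟩))⟩
  map_add' F₁ F₂ := by apply Subtype.ext; funext x; rfl
  map_smul' c F := by
    apply Subtype.ext; funext x
    change (c • F.1 ⟨x, hW ⟨x, rfl⟩⟩).re = c * (F.1 ⟨x, hW ⟨x, rfl⟩⟩).re
    simp

/-- Followed by the embedding into germs, this map is the canonical map `HolGerm.ofHolFun`,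
continuous by definition of the limit topology. It pulls functionals on `RealAnalyticFun` back to a
space with the compact-open topology. -/
theorem realHolFun.continuous_toRealAnalyticFun (W : Opens ℂ) (hW : realAxis ⊆ (W : Set ℂ)) :
    Continuous (realHolFun.toRealAnalyticFun W hW) := by
  have hcont : Continuous (HolGerm.ofHolFun W hW) := by
    exact continuous_sInf_rng.2 fun t ht => ht.2.2.2 W hW
  refine continuous_induced_rng.2 ?_
  have : RealAnalyticFun.toHolGerm ∘ realHolFun.toRealAnalyticFun W hW =
      HolGerm.ofHolFun W hW ∘ fun F : realHolFun W => (⟨F.1, F.2.1⟩ : HolFun W) := by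
    funext F
    apply Subtype.ext
    obtain ⟨g, hg, e⟩ := F.2.1
    have hext : ∀ (z : ℂ) (hz : z ∈ W),
        (Function.extend Subtype.val (F.1 : C(W, ℂ)) (0 : ℂ → ℂ) : ℂ → ℂ) z = F.1 ⟨z, hz⟩ :=
      fun z hz => Subtype.val_injective.extend_apply _ (0 : ℂ → ℂ) ⟨z, hz⟩
    refine RealAnalyticFun.extensionGerm_val_eq _ hW
      (hg.congr fun z hz => (hext z hz).trans (e ⟨z, hz⟩).symm) fun x => ?_
    rw [hext x (hW ⟨x, rfl⟩)]
    exact Complex.ext rfl (F.2.2 x _)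
  rw [this]
  exact hcont.comp (continuous_induced_rng.2 continuous_subtype_val)

/-! ### Functionals on spaces of continuous functions and holomorphic curves in `C(K, ℂ)` -/

/-- A continuous linear functional on a space of continuous functions with the compact-open
topology is dominated by the supremum seminorm of a compact set. -/
theorem exists_compact_bound {X : Type*} [TopologicalSpace X] (V : Submodule ℝ C(X, ℂ))
    (l : V →L[ℝ] ℝ) :
    ∃ K : Set X, IsCompact K ∧ ∃ C : ℝ, ∀ F : V, ∀ M : ℝ, 0 ≤ M → (∀ x ∈ K, ‖F.1 x‖ ≤ M) →
      |l F| ≤ C * M := by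
  have h₁ : {F : V | |l F| < 1} ∈ 𝓝 (0 : V) :=
    (isOpen_lt (continuous_abs.comp l.continuous) continuous_const).mem_nhds (by simp)
  rw [nhds_subtype, mem_comap] at h₁
  obtain ⟨T, hT, hTl⟩ := h₁
  obtain ⟨⟨K, U⟩, ⟨hK, hU⟩, hKU⟩ := (nhds_basis_uniformity'
    ContinuousMap.hasBasis_compactConvergenceUniformity).mem_iff.1 hT
  obtain ⟨ε, hε, hεU⟩ := Metric.mem_uniformity_dist.1 hU
  have key : ∀ F : V, (∀ x ∈ K, ‖F.1 x‖ < ε) → |l F| < 1 := fun F hF =>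
    hTl (hKU fun x hx => hεU (by simpa using hF x hx))
  refine ⟨K, hK, 2 / ε, fun F M hM hF => ?_⟩
  -- `M` may vanish, so `F` is rescaled with a positive `N ≥ M`, and then `N` tends to `M`.
  have hN : ∀ N, M ≤ N → 0 < N → |l F| ≤ 2 / ε * N := by
    intro N hMN hN
    have := key ((ε / (2 * N)) • F) fun x hx => by
      change ‖(ε / (2 * N)) • F.1 x‖ < ε
      rw [norm_smul, Real.norm_of_nonneg (by positivity)]
      calc ε / (2 * N) * ‖F.1 x‖ ≤ ε / (2 * N) * N := by gcongr; exact (hF x hx).trans hMN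
        _ = ε / 2 := by field_simp
        _ < ε := half_lt_self hε
    rw [map_smul, smul_eq_mul, abs_mul, abs_of_pos (by positivity), div_mul_eq_mul_div,
      div_lt_one (by positivity)] at this
    rw [div_mul_eq_mul_div, le_div_iff₀ hε]
    linarith
  have hlim : Tendsto (fun N => 2 / ε * N) (𝓝[>] M) (𝓝 (2 / ε * M)) :=
    ((continuous_const.mul continuous_id).tendsto M).mono_left inf_le_left
  refine ge_of_tendsto hlim ?_
  filter_upwards [self_mem_nhdsWithin] with N hMN
  exact hN N (le_of_lt hMN) (hM.trans_lt hMN)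

/-- Hahn–Banach theorem: a linear functional dominated by the seminorm `x ↦ C * ‖ρ x‖` factors
through `ρ`. -/
theorem exists_dual_extension {E N : Type*} [AddCommGroup E] [Module ℝ E] [NormedAddCommGroup N]
    [NormedSpace ℝ N] (ρ : E →ₗ[ℝ] N) (l : E →ₗ[ℝ] ℝ) (C : ℝ) (h : ∀ x, |l x| ≤ C * ‖ρ x‖) :
    ∃ L : N →L[ℝ] ℝ, ∀ x, L (ρ x) = l x := by
  have hker : LinearMap.ker ρ ≤ LinearMap.ker l := by
    intro x hx
    rw [LinearMap.mem_ker] at hx ⊢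
    have := h x
    rw [hx, norm_zero, mul_zero] at this
    exact abs_nonpos_iff.1 this
  -- Since `ker ρ ≤ ker l`, any linear section `σ` of `ρ` makes `l ∘ σ` the functional induced by
  -- `l` on the range.
  obtain ⟨σ, hσ⟩ := ρ.rangeRestrict.exists_rightInverse_of_surjective ρ.range_rangeRestrict
  let m : LinearMap.range ρ →ₗ[ℝ] ℝ := l ∘ₗ σ
  have hm : ∀ x, m (ρ.rangeRestrict x) = l x := by
    intro x
    have h₁ : ρ (σ (ρ.rangeRestrict x) - x) = 0 := by
      rw [map_sub, sub_eq_zero]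
      exact congrArg Subtype.val (LinearMap.congr_fun hσ (ρ.rangeRestrict x))
    have h₂ : l (σ (ρ.rangeRestrict x) - x) = 0 := hker h₁
    rwa [map_sub, sub_eq_zero] at h₂
  obtain ⟨L, hL, -⟩ := exists_extension_norm_eq (LinearMap.range ρ)
    (m.mkContinuous C (by
      rintro ⟨_, x, rfl⟩
      exact (congrArg _ (hm x)).trans_le (h x)))
  exact ⟨L, fun x => (hL (ρ.rangeRestrict x)).trans (hm x)⟩

/-- A continuous linear functional on a space of continuous functions with the compact-open
topology extends to the continuous functions on some compact set. -/
theorem exists_extension_compact {X : Type*} [TopologicalSpace X] (V : Submodule ℝ C(X, ℂ))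
    (l : V →L[ℝ] ℝ) :
    ∃ K : Set X, ∃ _ : CompactSpace K, ∃ L : C(K, ℂ) →L[ℝ] ℝ, ∀ F : V, L (F.1.restrict K) = l F := by
  obtain ⟨K, hK, C, hC⟩ := exists_compact_bound V l
  have hKc : CompactSpace K := isCompact_iff_compactSpace.1 hK
  let ρ : V →ₗ[ℝ] C(K, ℂ) :=
    { toFun := fun F => F.1.restrict K
      map_add' := fun _ _ => rfl
      map_smul' := fun _ _ => rfl }
  have hbound : ∀ F, |l F| ≤ C * ‖ρ F‖ := fun F =>
    hC F _ (norm_nonneg _) fun x hx => (ρ F).norm_coe_le_norm ⟨x, hx⟩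
  have hcoe : ∀ F, (l : V →ₗ[ℝ] ℝ) F = l F := fun _ => rfl
  obtain ⟨L, hL⟩ := exists_dual_extension (E := V) (N := C(K, ℂ)) ρ (l : V →ₗ[ℝ] ℝ) C
    fun F => (congrArg _ (hcoe F)).trans_le (hbound F)
  exact ⟨K, hKc, L, fun F => (hL F).trans (hcoe F)⟩

/-- A function of two variables that is holomorphic in the first one gives a holomorphic curve of
continuous functions in the second one. -/
theorem analyticAt_curry {K : Type*} [TopologicalSpace K] [CompactSpace K] {c : ℂ} {r : ℝ}
    (hr : 0 < r) {H : ℂ × K → ℂ} (hc : ContinuousOn H (Metric.closedBall c r ×ˢ univ))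
    (hd : ∀ k, DifferentiableOn ℂ (fun z => H (z, k)) (Metric.closedBall c r)) :
    ∃ Φ : ℂ → C(K, ℂ), AnalyticAt ℂ Φ c ∧ ∀ z ∈ Metric.ball c r, ∀ k, Φ z k = H (z, k) := by
  classical
  let H₀ : C(Metric.closedBall c r × K, ℂ) := ⟨fun p => H (p.1, p.2),
    hc.comp_continuous (by fun_prop) fun p => ⟨p.1.2, mem_univ _⟩⟩
  let h : ℂ → C(K, ℂ) := fun z => if hz : z ∈ Metric.closedBall c r then H₀.curry ⟨z, hz⟩ else 0
  have hh : ∀ z ∈ Metric.closedBall c r, ∀ k, h z k = H (z, k) := by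
    intro z hz k
    simp only [h, dif_pos hz]
    rfl
  have hcont : ContinuousOn h (Metric.closedBall c r) := by
    rw [continuousOn_iff_continuous_domRestrict]
    convert H₀.curry.continuous using 1
    funext z
    simp only [Set.domRestrict_apply, h, dif_pos z.2]
  have hint : ∀ w ∈ Metric.ball c r, CircleIntegrable (fun z => (z - w)⁻¹ • h z) c r := by
    intro w hw
    have hsub : ContinuousOn (fun z => z - w) (Metric.sphere c r) := by fun_prop
    refine ((hsub.inv₀ fun z hz => sub_ne_zero.2 ?_).smul
      (hcont.mono Metric.sphere_subset_closedBall)).circleIntegrable hr.le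
    rintro rfl
    exact (Metric.mem_ball.1 hw).ne (Metric.mem_sphere.1 hz)
  lift r to NNReal using hr.le
  -- The Cauchy integral is taken in `C(K, ℂ)`, so it is analytic in `w`. Evaluation at `k` commutes
  -- with it, and Cauchy's formula for `H (·, k)` gives its values.
  refine ⟨fun w => (2 * Real.pi * Complex.I : ℂ)⁻¹ • ∮ z in C(c, r), (z - w)⁻¹ • h z,
    (hasFPowerSeriesOn_cauchy_integral ((hcont.mono
      Metric.sphere_subset_closedBall).circleIntegrable hr.le) hr).analyticAt, fun w hw k => ?_⟩
  have hev : (∮ z in C(c, r), (z - w)⁻¹ • h z) k = ∮ z in C(c, r), (z - w)⁻¹ • h z k :=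
    ((ContinuousMap.evalCLM ℂ k).intervalIntegral_comp_comm (hint w hw).out).symm
  have hcauchy := (hd k).circleIntegral_sub_inv_smul hw
  rw [ContinuousMap.smul_apply, hev,
    circleIntegral.integral_congr (g := fun z => (z - w)⁻¹ • H (z, k)) hr.le fun z hz => by
      simp only [hh z (Metric.sphere_subset_closedBall hz) k], hcauchy,
    smul_smul, inv_mul_cancel₀ Complex.two_pi_I_ne_zero, one_smul]

theorem isRealAnalyticCurve_of_analyticOnNhd (f : ℝ → RealAnalyticFun)
    (hf : AnalyticOnNhd ℝ (fun p : ℝ × ℝ => f p.1 p.2) univ) : IsRealAnalyticCurve f := by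
  intro l s₀ _
  obtain ⟨Ω, G, hΩ, hΩr, hG, hGf⟩ := exists_holomorphic_extension_prod hf
  let I : Set ℂ := (↑) '' Icc (s₀ - 1) (s₀ + 1)
  have hI : IsCompact I := isCompact_Icc.image Complex.continuous_ofReal
  -- A common domain for all `G (s, ·)` with `s ∈ I`; it is open by the tube lemma because `I` is
  -- compact.
  let W : Opens ℂ := ⟨{z | ∀ s ∈ I, (s, z) ∈ Ω}, by
    refine isOpen_iff_mem_nhds.2 fun z hz => ?_
    obtain ⟨u, v, -, hv, hu, hzv, huv⟩ := generalized_tube_lemma hI (isCompact_singleton (x := z))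
      hΩ (by rintro ⟨a, b⟩ ⟨ha, rfl⟩; exact hz a ha)
    exact mem_of_superset (hv.mem_nhds (hzv rfl)) fun w hw s hs => huv ⟨hu hs, hw⟩⟩
  have hW : realAxis ⊆ (W : Set ℂ) := by
    rintro _ ⟨t, rfl⟩ _ ⟨s, -, rfl⟩
    exact hΩr s t
  have hGW : ∀ s ∈ I, DifferentiableOn ℂ (fun z => G (s, z)) W := fun s hs =>
    hG.comp (by fun_prop) fun z hz => hz s hs
  let j := realHolFun.toRealAnalyticFun W hW
  obtain ⟨K, hK, L, hL⟩ := exists_extension_compact (realHolFun W)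
    (l.comp ⟨j, realHolFun.continuous_toRealAnalyticFun W hW⟩)
  have hs₀ : (s₀ : ℂ) ∈ I := ⟨s₀, by simp, rfl⟩
  have hKW : IsCompact ((↑) '' K : Set ℂ) :=
    (isCompact_iff_compactSpace.2 hK).image continuous_subtype_val
  -- Only the compact `K` matters now, so a second tube lemma lets `s` move in a complex
  -- neighbourhood of `s₀`.
  obtain ⟨u, v, hu, hv, hsu, hKv, huv⟩ := generalized_tube_lemma (isCompact_singleton (x := (s₀ : ℂ)))
    hKW hΩ (by rintro ⟨_, _⟩ ⟨rfl, ⟨k, -, rfl⟩⟩; exact k.2 s₀ hs₀)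
  obtain ⟨r, hr, hru⟩ := Metric.nhds_basis_closedBall.mem_iff.1 (hu.mem_nhds (hsu rfl))
  obtain ⟨Φ, hΦ, hΦH⟩ := analyticAt_curry (K := K) hr (H := fun p => G (p.1, (p.2 : W)))
    (hG.continuousOn.comp (by fun_prop) fun p hp => huv ⟨hru hp.1, hKv ⟨p.2, p.2.2, rfl⟩⟩)
    (fun k => hG.comp (differentiableOn_id.prodMk (differentiableOn_const ((k : W) : ℂ))) fun z hz => huv ⟨hru hz, hKv ⟨k, k.2, rfl⟩⟩)
  have han : AnalyticAt ℝ (fun s : ℝ => L (Φ s)) s₀ :=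
    (L.analyticAt _).comp
      ((hΦ.restrictScalars (𝕜 := ℝ)).comp_of_eq (Complex.ofRealCLM.analyticAt s₀) rfl)
  refine han.congr ?_
  have h₁ : ∀ᶠ s : ℝ in 𝓝 s₀, s ∈ Icc (s₀ - 1) (s₀ + 1) := Icc_mem_nhds (by simp) (by simp)
  have h₂ : ∀ᶠ s : ℝ in 𝓝 s₀, (s : ℂ) ∈ Metric.ball (s₀ : ℂ) r :=
    Complex.continuous_ofReal.continuousAt.eventually (Metric.ball_mem_nhds _ hr)
  filter_upwards [h₁, h₂] with s hs₁ hs₂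
  have hsI : (s : ℂ) ∈ I := ⟨s, hs₁, rfl⟩
  let F : realHolFun W := ⟨⟨fun z => G (s, z), (hGW s hsI).continuousOn.domRestrict⟩,
    ⟨fun z => G (s, z), hGW s hsI, fun _ => rfl⟩, fun x hx => by
      change (G (s, x)).im = 0
      rw [hGf, Complex.ofReal_im]⟩
  have hF : Φ s = F.1.restrict K := by
    ext k
    exact hΦH s hs₂ k
  rw [hF, hL F]
  refine congrArg l (DFunLike.coe_injective ?_)
  funext x
  change (G (s, x)).re = _
  rw [hGf, Complex.ofReal_re]

/-! ### Power series of one variable with geometrically bounded coefficients -/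

section PowerSeries

variable {F : Type*} [NormedAddCommGroup F] [NormedSpace ℝ F] [CompleteSpace F]

/-- Coefficients are taken in a Banach space, since the series is also needed with values in `ℓ^∞`
and in its dual. -/
theorem hasFPowerSeriesOnBall_tsum_pow_smul {c : ℕ → F} {C k : ℝ} (hk : 0 < k)
    (hc : ∀ n, ‖c n‖ ≤ C * k ^ n) (x₀ : ℝ) :
    HasFPowerSeriesOnBall (fun x => ∑' n, (x - x₀) ^ n • c n)
      (fun n => ContinuousMultilinearMap.mkPiRing ℝ (Fin n) (c n)) x₀ (ENNReal.ofReal k⁻¹) := by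
  set p : FormalMultilinearSeries ℝ ℝ F :=
    fun n => ContinuousMultilinearMap.mkPiRing ℝ (Fin n) (c n) with hp
  have hrad : ENNReal.ofReal k⁻¹ ≤ p.radius := by
    refine p.le_radius_of_bound C fun n => ?_
    rw [Real.coe_toNNReal _ (inv_nonneg.2 hk.le), hp, ContinuousMultilinearMap.norm_mkPiRing]
    calc ‖c n‖ * k⁻¹ ^ n ≤ C * k ^ n * k⁻¹ ^ n := by gcongr; exact hc n
      _ = C := by rw [mul_assoc, ← mul_pow, mul_inv_cancel₀ hk.ne', one_pow, mul_one]
  have hpos : 0 < ENNReal.ofReal k⁻¹ := ENNReal.ofReal_pos.2 (inv_pos.2 hk)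
  have h := ((p.hasFPowerSeriesOnBall (hpos.trans_le hrad)).mono hpos hrad).comp_sub x₀
  rw [zero_add] at h
  convert h using 2 with x
  simp [FormalMultilinearSeries.sum, hp]

theorem mem_eball_iff_abs_sub_lt {x x₀ r : ℝ} :
    x ∈ Metric.eball x₀ (ENNReal.ofReal r) ↔ |x - x₀| < r := by
  rw [Metric.eball_ofReal, Metric.mem_ball, Real.dist_eq]

theorem hasSum_pow_smul {c : ℕ → F} {C k : ℝ} (hk : 0 < k) (hc : ∀ n, ‖c n‖ ≤ C * k ^ n)
    {x x₀ : ℝ} (hx : |x - x₀| < k⁻¹) :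
    HasSum (fun n => (x - x₀) ^ n • c n) (∑' n, (x - x₀) ^ n • c n) := by
  have := (hasFPowerSeriesOnBall_tsum_pow_smul hk hc x₀).hasSum_sub (mem_eball_iff_abs_sub_lt.2 hx)
  simpa using this

/-- An analytic function on `ℝ` is represented by its power series on the whole interval of
convergence of the series. -/
theorem AnalyticOnNhd.hasSum_of_eventually_hasSum {h : ℝ → ℝ} (hh : AnalyticOnNhd ℝ h univ)
    {c : ℕ → ℝ} {C k : ℝ} (hk : 0 < k) (hc : ∀ n, |c n| ≤ C * k ^ n) {x₀ : ℝ}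
    (hev : ∀ᶠ x in 𝓝 x₀, HasSum (fun n => c n * (x - x₀) ^ n) (h x)) {x : ℝ}
    (hx : |x - x₀| < k⁻¹) : HasSum (fun n => c n * (x - x₀) ^ n) (h x) := by
  have hps := hasFPowerSeriesOnBall_tsum_pow_smul (F := ℝ) hk hc x₀
  have heq := hps.analyticOnNhd.eqOn_of_preconnected_of_eventuallyEq (hh.mono (subset_univ _))
    (by rw [Metric.eball_ofReal]; exact (convex_ball x₀ k⁻¹).isPreconnected)
    (Metric.mem_eball_self hps.r_pos) (by
      filter_upwards [hev] with y hy
      rw [← hy.tsum_eq]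
      simp [mul_comm]) (mem_eball_iff_abs_sub_lt.2 hx)
  rw [← heq]
  simpa [mul_comm] using hasSum_pow_smul (F := ℝ) hk hc hx

theorem AnalyticAt.eventually_hasSum_iteratedDeriv {𝕜 : Type*} [NontriviallyNormedField 𝕜]
    [CompleteSpace 𝕜] [CharZero 𝕜] {f : 𝕜 → 𝕜} {x₀ : 𝕜} (hf : AnalyticAt 𝕜 f x₀) :
    ∀ᶠ x in 𝓝 x₀, HasSum (fun n => iteratedDeriv n f x₀ / n.factorial * (x - x₀) ^ n) (f x) := by
  filter_upwards [hf.hasFPowerSeriesAt.eventually_hasSum_sub] with x hx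
  simpa [FormalMultilinearSeries.ofScalars_apply_eq, mul_comm] using hx

theorem AnalyticAt.exists_iteratedDeriv_bound {f : ℝ → ℝ} {x₀ : ℝ} (hf : AnalyticAt ℝ f x₀) :
    ∃ C k : ℝ, 0 < C ∧ 0 < k ∧ ∀ n, |iteratedDeriv n f x₀ / n.factorial| ≤ C * k ^ n := by
  obtain ⟨C, k, hC, hk, h⟩ :=
    FormalMultilinearSeries.le_mul_pow_of_radius_pos _ hf.hasFPowerSeriesAt.radius_pos
  refine ⟨C, k, hC, hk, fun n => ?_⟩
  exact (FormalMultilinearSeries.ofScalars_norm (𝕜 := ℝ) ℝ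
    (fun n => iteratedDeriv n f x₀ / n.factorial) n).symm.trans_le (h n)

end PowerSeries

/-! ### Uniform bounds for families of analytic functions -/

/-- The Taylor coefficients of a scalarwise analytic family of continuous linear functionals on a
Banach space are uniformly geometrically bounded. -/
theorem exists_iteratedDeriv_bound_of_dual {X : Type*} [NormedAddCommGroup X] [NormedSpace ℝ X]
    [CompleteSpace X] (T : ℝ → X →L[ℝ] ℝ) (hT : ∀ x, AnalyticOnNhd ℝ (fun s => T s x) univ)
    (s₀ : ℝ) :
    ∃ C k : ℝ, 0 ≤ C ∧ 0 < k ∧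
      ∀ m x, |iteratedDeriv m (fun s => T s x) s₀ / m.factorial| ≤ C * k ^ m * ‖x‖ := by
  have hD : ∀ m : ℕ, ∃ D : ℝ → X →L[ℝ] ℝ, ∀ s x, D s x = iteratedDeriv m (fun s => T s x) s := by
    intro m
    induction m with
    | zero => exact ⟨T, fun s x => by simp⟩
    | succ m ih =>
      -- Banach–Steinhaus: a pointwise limit of difference quotients of continuous functionals is
      -- again a continuous functional.
      obtain ⟨D, hD⟩ := ih
      have hlim : ∀ s, Tendsto (fun u x => ((u - s)⁻¹ • (D u - D s)) x) (𝓝[≠] s)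
          (𝓝 fun x => iteratedDeriv (m + 1) (fun s => T s x) s) := by
        intro s
        refine tendsto_pi_nhds.2 fun x => ?_
        have hd := ((hT x).contDiff (n := (⊤ : ℕ∞))).differentiable_iteratedDeriv m
          (by exact_mod_cast ENat.natCast_lt_top m)
        have := hasDerivAt_iff_tendsto_slope.1 (hd s).hasDerivAt
        rw [iteratedDeriv_succ]
        refine this.congr fun u => ?_
        rw [slope_def_module, ← hD, ← hD]
        rfl
      exact ⟨fun s => continuousLinearMapOfTendsto _ (hlim s), fun s x => rfl⟩
  choose D hD using hD
  -- Baire's theorem is applied to the closed sets `S k`; a single integer serves as both constant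
  -- and ratio, so countably many sets suffice.
  let S : ℕ → Set X := fun k => {x | ∀ m, |D m s₀ x / m.factorial| ≤ k * (k : ℝ) ^ m}
  have hclosed : ∀ k, IsClosed (S k) := fun k => by
    simp only [S, Set.ofPred_forall]
    exact isClosed_iInter fun m =>
      isClosed_le (continuous_abs.comp ((D m s₀).continuous.div_const _)) continuous_const
  have hunion : ⋃ k, S k = univ := by
    refine eq_univ_of_forall fun x => mem_iUnion.2 ?_
    obtain ⟨C, k, hC, hk, hb⟩ := (hT x s₀ (mem_univ _)).exists_iteratedDeriv_bound
    obtain ⟨j, hj⟩ := exists_nat_ge (max C k)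
    refine ⟨j, fun m => ?_⟩
    rw [hD]
    refine (hb m).trans ?_
    have h₁ : C ≤ j := (le_max_left _ _).trans hj
    have h₂ : k ≤ j := (le_max_right _ _).trans hj
    gcongr
  obtain ⟨k, x₀, hx₀⟩ := nonempty_interior_of_iUnion_of_closed hclosed hunion
  obtain ⟨ε, hε, hball⟩ := Metric.nhds_basis_closedBall.mem_iff.1 (mem_interior_iff_mem_nhds.1 hx₀)
  refine ⟨2 * (k + 1) / ε, k + 1, by positivity, by positivity, fun m x => ?_⟩
  rw [← hD]
  rcases eq_or_ne x 0 with rfl | hx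
  · simp
  have hx' : 0 < ‖x‖ := norm_pos_iff.2 hx
  have h₀ := hball (Metric.mem_closedBall_self hε.le) m
  have h₁ := hball (show x₀ + (ε / ‖x‖) • x ∈ Metric.closedBall x₀ ε by
    rw [Metric.mem_closedBall, dist_self_add_left, norm_smul, Real.norm_of_nonneg (by positivity),
      div_mul_cancel₀ _ hx'.ne']) m
  -- The scaled vector is a difference of two points of the ball inside `S k`, hence the factor `2`.
  have h₂ : ε / ‖x‖ * |D m s₀ x / m.factorial| ≤ 2 * (k * (k : ℝ) ^ m) := by
    rw [← abs_of_pos (div_pos hε hx'), ← abs_mul]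
    have : ε / ‖x‖ * (D m s₀ x / m.factorial) =
        D m s₀ (x₀ + (ε / ‖x‖) • x) / m.factorial - D m s₀ x₀ / m.factorial := by
      rw [map_add, map_smul, smul_eq_mul]; ring
    rw [this]
    refine (abs_sub _ _).trans ?_
    linarith
  have h₃ : (k * (k : ℝ) ^ m) ≤ (k + 1) * ((k : ℝ) + 1) ^ m := by gcongr <;> linarith
  rw [div_mul_eq_mul_div, div_le_iff₀ hx'] at h₂
  rw [div_mul_eq_mul_div, div_mul_eq_mul_div, le_div_iff₀ hε]
  nlinarith

/-- A double sequence that is geometrically bounded in the first index after multiplication by any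
superexponentially decreasing weight in the second index is geometrically bounded in both. -/
theorem exists_bound_of_weighted_bound (a : ℕ → ℕ → ℝ)
    (h : ∀ w : ℕ → ℝ, (∀ n, 0 < w n) → (∀ R > 0, Summable fun n => w n * R ^ n) →
      ∃ C k : ℝ, 0 < k ∧ ∀ m n, w n * |a m n| ≤ C * k ^ m) :
    ∃ C k : ℝ, 0 < k ∧ ∀ m n, |a m n| ≤ C * k ^ m * k ^ n := by
  by_contra! hcon
  choose M N hMN using fun j : ℕ => hcon (j + 1) (j + 1) (by positivity)
  -- At each bad index `N j` one has `J (N j) ≤ j`, yet `J` tends to infinity because each `j`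
  -- equals `J n` for finitely many `n` only. The alternative `n ≤ j` keeps the set nonempty.
  let J : ℕ → ℕ := fun n => sInf {j | N j = n ∨ n ≤ j}
  have hJN : ∀ j, J (N j) ≤ j := fun j => Nat.sInf_le (Or.inl rfl)
  have hJ : Tendsto J atTop atTop := by
    refine tendsto_atTop.2 fun b => ?_
    filter_upwards [eventually_gt_atTop (b + ∑ j ∈ Finset.range b, N j)] with n hn
    by_contra! hlt
    have hmem : J n ∈ {j | N j = n ∨ n ≤ j} := Nat.sInf_mem ⟨n, Or.inr le_rfl⟩
    rcases hmem with h₁ | h₁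
    · have := Finset.single_le_sum (f := N) (fun _ _ => Nat.zero_le _) (Finset.mem_range.2 hlt)
      omega
    · omega
  -- As `J → ∞`, this weight beats every geometric sequence, but at `N j` it is at least `(j + 1) ^
  -- (-N j)`, too large for the violation chosen at `j ≥ max C k`.
  let w : ℕ → ℝ := fun n => (((J n : ℝ) + 1) ^ n)⁻¹
  obtain ⟨C, k, hk, hb⟩ := h w (fun n => by positivity) fun R hR => by
    refine Summable.of_norm_bounded_eventually_nat (summable_geometric_of_lt_one (r := (1 / 2 : ℝ))
      (by norm_num) (by norm_num)) ?_
    filter_upwards [hJ.eventually_ge_atTop ⌈2 * R⌉₊] with n hn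
    have h₁ : 2 * R ≤ J n := (Nat.le_ceil _).trans (by exact_mod_cast hn)
    rw [Real.norm_of_nonneg (by positivity)]
    simp only [w]
    rw [← inv_pow, ← mul_pow]
    gcongr
    rw [inv_mul_le_iff₀ (by positivity)]
    linarith
  obtain ⟨j, hj⟩ := exists_nat_ge (max C k)
  have h₁ : C ≤ j := (le_max_left _ _).trans hj
  have h₂ : k ≤ j := (le_max_right _ _).trans hj
  refine (hb (M j) (N j)).not_gt ?_
  simp only [w]
  rw [inv_mul_eq_div, lt_div_iff₀ (by positivity)]
  refine lt_of_le_of_lt ?_ (hMN j)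
  have h₃ : (J (N j) : ℝ) ≤ j := by exact_mod_cast hJN j
  gcongr <;> linarith

/-! ### The pairing of summable with bounded sequences -/

/-- The functional `x ↦ ∑ yₙ xₙ` on the space of bounded sequences. -/
noncomputable def summablePairing (y : ℕ → ℝ) (hy : Summable fun n => |y n|) :
    (BoundedContinuousFunction ℕ ℝ) →L[ℝ] ℝ :=
  have hb : ∀ (x : BoundedContinuousFunction ℕ ℝ) n, ‖y n * x n‖ ≤ |y n| * ‖x‖ := fun x n => by
    rw [norm_mul]
    exact mul_le_mul_of_nonneg_left (x.norm_coe_le_norm n) (abs_nonneg _)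
  have hs : ∀ x : BoundedContinuousFunction ℕ ℝ, Summable fun n => y n * x n := fun x =>
    .of_norm_bounded (hy.mul_right ‖x‖) (hb x)
  LinearMap.mkContinuous
    { toFun := fun x => ∑' n, y n * x n
      map_add' := fun x₁ x₂ => by
        rw [← (hs x₁).tsum_add (hs x₂)]
        simp [mul_add]
      map_smul' := fun c x => by
        simp only [RingHom.id_apply, smul_eq_mul]
        rw [← tsum_mul_left]
        refine tsum_congr fun n => ?_
        change y n * (c * x n) = c * (y n * x n)
        ring }
    (∑' n, |y n|) fun x => by
      rw [← tsum_mul_right]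
      exact tsum_of_norm_bounded (hy.mul_right ‖x‖).hasSum (hb x)

theorem summablePairing_apply (y : ℕ → ℝ) (hy : Summable fun n => |y n|)
    (x : BoundedContinuousFunction ℕ ℝ) : summablePairing y hy x = ∑' n, y n * x n := rfl

theorem norm_summablePairing_le (y : ℕ → ℝ) (hy : Summable fun n => |y n|) :
    ‖summablePairing y hy‖ ≤ ∑' n, |y n| :=
  ContinuousLinearMap.opNorm_le_bound _ (tsum_nonneg fun _ => abs_nonneg _) fun x => by
    rw [summablePairing_apply, ← tsum_mul_right]
    refine tsum_of_norm_bounded (hy.mul_right ‖x‖).hasSum fun n => ?_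
    rw [norm_mul]
    exact mul_le_mul_of_nonneg_left (x.norm_coe_le_norm n) (abs_nonneg _)

/-- The unit vectors in the space of bounded sequences. -/
noncomputable def unitSeq (n : ℕ) : BoundedContinuousFunction ℕ ℝ :=
  .ofNormedAddCommGroupDiscrete (Pi.single n 1) 1 fun i => by
    rcases eq_or_ne i n with rfl | h
    · simp
    · simp [h]

theorem norm_unitSeq_le (n : ℕ) : ‖unitSeq n‖ ≤ 1 :=
  BoundedContinuousFunction.norm_ofNormedAddCommGroup_le _ zero_le_one fun i => by
    rcases eq_or_ne i n with rfl | h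
    · simp
    · simp [h]

theorem summablePairing_unitSeq (y : ℕ → ℝ) (hy : Summable fun n => |y n|) (n : ℕ) :
    summablePairing y hy (unitSeq n) = y n := by
  rw [summablePairing_apply, tsum_eq_single n]
  · simp [unitSeq]
  · intro i hi
    simp [unitSeq, hi]

/-- For a weight `w`, the sequences `(w n * A n s)ₙ` are functionals on `ℓ^∞`; paired with a bounded
`x` they are analytic in `s` by `han` with `μ = w x`. Testing the uniform bound on unit vectors
gives the input of `exists_bound_of_weighted_bound`. -/
theorem exists_iteratedDeriv_bound_of_weighted (A : ℕ → ℝ → ℝ)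
    (hA : ∀ s, ∃ C k : ℝ, 0 < k ∧ ∀ n, |A n s| ≤ C * k ^ n)
    (han : ∀ μ : ℕ → ℝ, (∀ R > 0, Summable fun n => |μ n| * R ^ n) →
      AnalyticOnNhd ℝ (fun s => ∑' n, μ n * A n s) univ) (s₀ : ℝ) :
    ∃ C k : ℝ, 0 < k ∧
      ∀ m n, |iteratedDeriv m (A n) s₀ / m.factorial| ≤ C * k ^ m * k ^ n := by
  refine exists_bound_of_weighted_bound (fun m n => iteratedDeriv m (A n) s₀ / m.factorial)
    fun w hw hwR => ?_
  have hsum : ∀ s, Summable fun n => |w n * A n s| := by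
    intro s
    obtain ⟨C, k, hk, hb⟩ := hA s
    refine Summable.of_norm_bounded ((hwR k hk).mul_left C) fun n => ?_
    rw [Real.norm_eq_abs, abs_abs, abs_mul, abs_of_pos (hw n)]
    calc w n * |A n s| ≤ w n * (C * k ^ n) := mul_le_mul_of_nonneg_left (hb n) (hw n).le
      _ = C * (w n * k ^ n) := by ring
  obtain ⟨C, k, hC, hk, hb⟩ := exists_iteratedDeriv_bound_of_dual
    (fun s => summablePairing _ (hsum s)) (fun x => by
      have := han (fun n => w n * x n) fun R hR => by
        refine Summable.of_norm_bounded ((hwR R hR).mul_left ‖x‖) fun n => ?_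
        rw [Real.norm_of_nonneg (by positivity), abs_mul, abs_of_pos (hw n)]
        calc w n * |x n| * R ^ n ≤ w n * ‖x‖ * R ^ n := by
              have := hw n
              gcongr
              exact x.norm_coe_le_norm n
          _ = ‖x‖ * (w n * R ^ n) := by ring
      convert this using 2 with s
      rw [summablePairing_apply]
      exact tsum_congr fun n => by ring) s₀
  refine ⟨C, k, hk, fun m n => ?_⟩
  have h := hb m (unitSeq n)
  simp only [summablePairing_unitSeq] at h
  rw [show (fun s => w n * A n s) = (w n) • A n from rfl, iteratedDeriv_const_smul_field,
    smul_eq_mul, mul_div_assoc, abs_mul, abs_of_pos (hw n)] at h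
  refine h.trans (mul_le_of_le_one_right (by positivity) (norm_unitSeq_le n))

theorem AnalyticAt.clm_apply_apply {E X : Type*} [NormedAddCommGroup E] [NormedSpace ℝ E]
    [NormedAddCommGroup X] [NormedSpace ℝ X] {a : E → X →L[ℝ] ℝ} {b : E → X} {e : E}
    (ha : AnalyticAt ℝ a e) (hb : AnalyticAt ℝ b e) : AnalyticAt ℝ (fun e => a e (b e)) e :=
  ((ContinuousLinearMap.id ℝ (X →L[ℝ] ℝ)).analyticAt_bilinear (a e, b e)).comp_of_eq
    (g := fun q : (X →L[ℝ] ℝ) × X => q.1 q.2) (f := fun e => (a e, b e)) (ha.prod hb) rfl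

/-- Joint analyticity of a function of two variables from the analyticity of its Taylor coefficients
in the second variable, under a geometric bound for the double series. -/
theorem analyticAt_prod_of_iteratedDeriv_bound {F : ℝ → ℝ → ℝ} {A : ℕ → ℝ → ℝ} {s₀ t₀ C k : ℝ}
    (hk : 0 < k) (hF : ∀ s, AnalyticOnNhd ℝ (F s) univ) (hA : ∀ n, AnalyticOnNhd ℝ (A n) univ)
    (hFA : ∀ s, ∀ᶠ t in 𝓝 t₀, HasSum (fun n => A n s * (t - t₀) ^ n) (F s t))
    (hb : ∀ m n, |iteratedDeriv m (A n) s₀ / m.factorial| ≤ C * k ^ m * k ^ n) :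
    AnalyticAt ℝ (fun p : ℝ × ℝ => F p.1 p.2) (s₀, t₀) := by
  have hAs : ∀ n s, |s - s₀| < k⁻¹ →
      HasSum (fun m => iteratedDeriv m (A n) s₀ / m.factorial * (s - s₀) ^ m) (A n s) :=
    fun n s hs => (hA n).hasSum_of_eventually_hasSum (C := C * k ^ n) hk
      (fun m => (hb m n).trans_eq (by ring))
      (hA n s₀ (mem_univ _)).eventually_hasSum_iteratedDeriv hs
  -- At half the radius the series over `m` is dominated by a geometric one with sum `2`. The bound
  -- is uniform in `s`, so the `t`-series represents `F s` on an interval independent of `s`.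
  have hAb : ∀ s, |s - s₀| < (2 * k)⁻¹ → ∀ n, |A n s| ≤ C * 2 * k ^ n := by
    intro s hs n
    have hs' : |s - s₀| < k⁻¹ := hs.trans_le (by gcongr; linarith)
    rw [← (hAs n s hs').tsum_eq]
    rw [show C * 2 * k ^ n = C * k ^ n * ∑' m : ℕ, (1 / 2 : ℝ) ^ m by rw [tsum_geometric_two]; ring]
    rw [← Real.norm_eq_abs]
    refine tsum_of_norm_bounded (summable_geometric_two.hasSum.mul_left (C * k ^ n)) fun m => ?_
    rw [norm_mul, norm_pow, Real.norm_eq_abs, Real.norm_eq_abs]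
    calc _ ≤ C * k ^ m * k ^ n * (2 * k)⁻¹ ^ m := by
          gcongr
          · exact (abs_nonneg _).trans (hb m n)
          · exact hb m n
      _ = C * k ^ n * (1 / 2) ^ m := by
          rw [mul_inv, mul_pow, one_div, inv_pow k]
          field_simp
  have hFs : ∀ s, |s - s₀| < (2 * k)⁻¹ → ∀ t, |t - t₀| < k⁻¹ →
      HasSum (fun n => A n s * (t - t₀) ^ n) (F s t) := fun s hs t ht =>
    (hF s).hasSum_of_eventually_hasSum hk (hAb s hs) (hFA s) ht
  have hyb : ∀ m n, |iteratedDeriv m (A n) s₀ / m.factorial * (2 * k)⁻¹ ^ n| ≤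
      C * k ^ m * (1 / 2) ^ n := by
    intro m n
    rw [abs_mul, abs_of_nonneg (a := (2 * k)⁻¹ ^ n) (by positivity)]
    calc _ ≤ C * k ^ m * k ^ n * (2 * k)⁻¹ ^ n := by gcongr; exact hb m n
      _ = C * k ^ m * (1 / 2) ^ n := by
          rw [mul_inv, mul_pow, one_div, inv_pow k]
          field_simp
  have hy : ∀ m, Summable fun n => |iteratedDeriv m (A n) s₀ / m.factorial * (2 * k)⁻¹ ^ n| :=
    fun m => Summable.of_nonneg_of_le (fun _ => abs_nonneg _) (hyb m)
      (summable_geometric_two.mul_left _)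
  -- `F` is written as a bounded bilinear pairing of an analytic function of `s` with one of `t`.
  -- The factor `(2 * k)⁻¹ ^ n` makes `α m` summable, and `β n` compensates for it.
  let α : ℕ → BoundedContinuousFunction ℕ ℝ →L[ℝ] ℝ := fun m => summablePairing _ (hy m)
  have hα : ∀ m, ‖α m‖ ≤ C * 2 * k ^ m := fun m => by
    refine (norm_summablePairing_le _ (hy m)).trans
      (((hy m).tsum_le_tsum (hyb m) (summable_geometric_two.mul_left _)).trans_eq ?_)
    rw [tsum_mul_left, tsum_geometric_two]
    ring
  let β : ℕ → BoundedContinuousFunction ℕ ℝ := fun n => (2 * k) ^ n • unitSeq n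
  have h2k : 0 < 2 * k := by positivity
  have hβ : ∀ n, ‖β n‖ ≤ 1 * (2 * k) ^ n := fun n => by
    rw [norm_smul, one_mul, Real.norm_of_nonneg (by positivity)]
    exact mul_le_of_le_one_right (by positivity) (norm_unitSeq_le n)
  have hA' := (hasFPowerSeriesOnBall_tsum_pow_smul (F := BoundedContinuousFunction ℕ ℝ →L[ℝ] ℝ) hk hα s₀).analyticAt
  have hB' := (hasFPowerSeriesOnBall_tsum_pow_smul h2k hβ t₀).analyticAt
  have hjoint : AnalyticAt ℝ (fun p : ℝ × ℝ =>
      (∑' m, (p.1 - s₀) ^ m • α m) (∑' n, (p.2 - t₀) ^ n • β n)) (s₀, t₀) :=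
    (hA'.comp_of_eq analyticAt_fst rfl).clm_apply_apply (hB'.comp_of_eq analyticAt_snd rfl)
  refine hjoint.congr ?_
  have hs : ∀ᶠ p : ℝ × ℝ in 𝓝 (s₀, t₀), |p.1 - s₀| < (2 * k)⁻¹ :=
    (by fun_prop : Continuous fun p : ℝ × ℝ => |p.1 - s₀|).continuousAt.eventually_lt_const
      (by simpa using hk)
  have ht : ∀ᶠ p : ℝ × ℝ in 𝓝 (s₀, t₀), |p.2 - t₀| < (2 * k)⁻¹ :=
    (by fun_prop : Continuous fun p : ℝ × ℝ => |p.2 - t₀|).continuousAt.eventually_lt_const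
      (by simpa using hk)
  filter_upwards [hs, ht] with ⟨s, t⟩ hs ht
  dsimp only at hs ht ⊢
  have hle : (2 * k)⁻¹ ≤ k⁻¹ := by gcongr; linarith
  have hS := hasSum_pow_smul (F := BoundedContinuousFunction ℕ ℝ →L[ℝ] ℝ) hk hα (hs.trans_le hle)
  have hT := hasSum_pow_smul h2k hβ ht
  have hval : ∀ n, (∑' m, (s - s₀) ^ m • α m) (β n) = A n s := by
    intro n
    have h₁ := hS.mapL (ContinuousLinearMap.apply ℝ ℝ (β n))
    refine h₁.unique ((hAs n s (hs.trans_le hle)).congr_fun fun m => ?_)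
    change (s - s₀) ^ m * α m ((2 * k) ^ n • unitSeq n) = _
    rw [map_smul, summablePairing_unitSeq, smul_eq_mul, inv_pow]
    field_simp
  refine ((hT.mapL (∑' m, (s - s₀) ^ m • α m)).unique ?_)
  simp only [map_smul, hval, smul_eq_mul]
  simpa only [mul_comm] using hFs s hs t (ht.trans_le hle)

/-! ### Continuous functionals on spaces of germs -/

namespace HolGerm

/-- The topology induced by `L` is itself one of the locally convex topologies whose infimum defines
the limit topology. -/
theorem continuous_of_comp_ofHolFun {A : Set ℂ} (L : HolGerm A →ₗ[ℂ] ℂ)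
    (h : ∀ (W : Opens ℂ) (hA : A ⊆ (W : Set ℂ)), Continuous fun F => L (ofHolFun W hA F)) :
    Continuous L := by
  refine continuous_iff_le_induced.2 (sInf_le ⟨topologicalAddGroup_induced L,
    continuousSMul_induced L, LocallyConvexSpace.induced (L.restrictScalars ℝ), fun W hA => ?_⟩)
  exact continuous_induced_rng.2 (h W hA)

variable {A : Set ℂ} {c : ℂ}

theorem exists_rep (φ : HolGerm A) :
    ∃ (W : Opens ℂ) (g : ℂ → ℂ), A ⊆ (W : Set ℂ) ∧
      DifferentiableOn ℂ g (W : Set ℂ) ∧ (g : Germ (𝓝ˢ A) ℂ) = φ.1 := φ.2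

/-- The Taylor coefficients of a germ at a point of `A`. -/
noncomputable def coeff (hc : c ∈ A) (n : ℕ) (φ : HolGerm A) : ℂ :=
  φ.1.liftOn (fun g => iteratedDeriv n g c / n.factorial) fun _ _ h => by
    dsimp only
    rw [(h.filter_mono (nhds_le_nhdsSet hc)).iteratedDeriv_eq]

theorem coeff_eq (hc : c ∈ A) (n : ℕ) {φ : HolGerm A} {g : ℂ → ℂ}
    (h : φ.1 = (g : Germ (𝓝ˢ A) ℂ)) : coeff hc n φ = iteratedDeriv n g c / n.factorial := by
  rw [coeff, h]
  rfl

theorem coeff_add (hc : c ∈ A) (n : ℕ) (φ₁ φ₂ : HolGerm A) :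
    coeff hc n (φ₁ + φ₂) = coeff hc n φ₁ + coeff hc n φ₂ := by
  obtain ⟨W₁, g₁, hW₁, h₁, e₁⟩ := φ₁.exists_rep
  obtain ⟨W₂, g₂, hW₂, h₂, e₂⟩ := φ₂.exists_rep
  have h : (φ₁ + φ₂ : HolGerm A).1 = ((g₁ + g₂ : ℂ → ℂ) : Germ (𝓝ˢ A) ℂ) := by
    change φ₁.1 + φ₂.1 = _
    rw [← e₁, ← e₂]
    rfl
  rw [coeff_eq hc n e₁.symm, coeff_eq hc n e₂.symm, coeff_eq hc n h, ← add_div,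
    iteratedDeriv_add ((h₁.analyticAt (W₁.isOpen.mem_nhds (hW₁ hc))).contDiffAt)
      ((h₂.analyticAt (W₂.isOpen.mem_nhds (hW₂ hc))).contDiffAt)]

theorem coeff_smul (hc : c ∈ A) (n : ℕ) (a : ℂ) (φ : HolGerm A) :
    coeff hc n (a • φ) = a * coeff hc n φ := by
  obtain ⟨W, g, -, -, e⟩ := φ.exists_rep
  have h : (a • φ : HolGerm A).1 = ((a • g : ℂ → ℂ) : Germ (𝓝ˢ A) ℂ) := by
    change a • φ.1 = _
    rw [← e]
    rfl
  rw [coeff_eq hc n e.symm, coeff_eq hc n h, iteratedDeriv_const_smul_field, smul_eq_mul,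
    mul_div_assoc]

theorem norm_coeff_le (hc : c ∈ A) {W : Opens ℂ} {g : ℂ → ℂ} {φ : HolGerm A}
    (h : φ.1 = (g : Germ (𝓝ˢ A) ℂ)) (hg : DifferentiableOn ℂ g (W : Set ℂ)) {r M : ℝ} (hr : 0 < r)
    (hrW : Metric.closedBall c r ⊆ W) (hM : ∀ z ∈ Metric.sphere c r, ‖g z‖ ≤ M) (n : ℕ) :
    ‖coeff hc n φ‖ ≤ M * r⁻¹ ^ n := by
  have := Complex.norm_iteratedDeriv_le_of_forall_mem_sphere_norm_le n hr
    ((hg.mono hrW).diffContOnCl_ball le_rfl) hM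
  rw [coeff_eq hc n h, norm_div, Complex.norm_natCast, div_le_iff₀ (by positivity)]
  refine this.trans_eq ?_
  rw [inv_pow]
  field_simp

theorem exists_coeff_bound (hc : c ∈ A) (φ : HolGerm A) :
    ∃ C k : ℝ, 0 < k ∧ ∀ n, ‖coeff hc n φ‖ ≤ C * k ^ n := by
  obtain ⟨W, g, hW, hg, e⟩ := φ.exists_rep
  obtain ⟨r, hr, hrW⟩ := Metric.nhds_basis_closedBall.mem_iff.1 (W.isOpen.mem_nhds (hW hc))
  obtain ⟨M, hM⟩ := (isCompact_sphere c r).exists_bound_of_continuousOn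
    (hg.continuousOn.mono (Metric.sphere_subset_closedBall.trans hrW))
  exact ⟨M, r⁻¹, inv_pos.2 hr, norm_coeff_le hc e.symm hg hr hrW hM⟩

/-- The geometric growth rate depends on the germ, so `μ` must beat all rates at once. -/
theorem summable_mul_coeff (hc : c ∈ A) {μ : ℕ → ℝ}
    (hμ : ∀ R > 0, Summable fun n => |μ n| * R ^ n) (φ : HolGerm A) :
    Summable fun n => (μ n : ℂ) * coeff hc n φ := by
  obtain ⟨C, k, hk, h⟩ := exists_coeff_bound hc φ
  refine Summable.of_norm_bounded ((hμ k hk).mul_left C) fun n => ?_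
  rw [norm_mul, Complex.norm_real, Real.norm_eq_abs]
  exact (mul_le_mul_of_nonneg_left (h n) (abs_nonneg _)).trans_eq (by ring)

/-- The functional on germs given by a superexponentially decreasing combination of Taylor
coefficients. -/
noncomputable def coeffSeries (hc : c ∈ A) (μ : ℕ → ℝ)
    (hμ : ∀ R > 0, Summable fun n => |μ n| * R ^ n) : HolGerm A →ₗ[ℂ] ℂ where
  toFun φ := ∑' n, (μ n : ℂ) * coeff hc n φ
  map_add' φ₁ φ₂ := by
    rw [← (summable_mul_coeff hc hμ φ₁).tsum_add (summable_mul_coeff hc hμ φ₂)]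
    simp only [coeff_add, mul_add]
  map_smul' a φ := by
    rw [RingHom.id_apply, smul_eq_mul, ← tsum_mul_left]
    refine tsum_congr fun n => ?_
    rw [coeff_smul]
    ring

theorem continuous_coeffSeries (hc : c ∈ A) (μ : ℕ → ℝ)
    (hμ : ∀ R > 0, Summable fun n => |μ n| * R ^ n) : Continuous (coeffSeries hc μ hμ) := by
  refine continuous_of_comp_ofHolFun _ fun W hW => ?_
  obtain ⟨r, hr, hrW⟩ := Metric.nhds_basis_closedBall.mem_iff.1 (W.isOpen.mem_nhds (hW hc))
  -- By Cauchy's inequality the sup norm on this one circle controls all coefficients.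
  let S : Set W := Subtype.val ⁻¹' Metric.sphere c r
  have hS : CompactSpace S := isCompact_iff_compactSpace.1 <|
    Topology.IsInducing.subtypeVal.isCompact_preimage' (isCompact_sphere c r)
      (by simpa using Metric.sphere_subset_closedBall.trans hrW)
  have hbound : ∀ F : HolFun W, ‖coeffSeries hc μ hμ (ofHolFun W hW F)‖ ≤
      (∑' n, |μ n| * r⁻¹ ^ n) * ‖(F : C(W, ℂ)).restrict S‖ := by
    intro F
    obtain ⟨g, hg, e⟩ := F.2
    have hgF : (ofHolFun W hW F).1 = (g : Germ (𝓝ˢ A) ℂ) := by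
      refine Germ.coe_eq.2 (mem_of_superset (W.isOpen.mem_nhdsSet.2 hW) fun z hz => ?_)
      exact (Subtype.val_injective.extend_apply _ (0 : ℂ → ℂ) ⟨z, hz⟩).trans (e ⟨z, hz⟩).symm
    have hc' := norm_coeff_le hc hgF hg hr hrW
      (M := ‖(F : C(W, ℂ)).restrict S‖) fun z hz => by
        have hzW : z ∈ W := hrW (Metric.sphere_subset_closedBall hz)
        rw [e ⟨z, hzW⟩]
        exact ((F : C(W, ℂ)).restrict S).norm_coe_le_norm ⟨⟨z, hzW⟩, hz⟩
    rw [← tsum_mul_right]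
    refine tsum_of_norm_bounded ((hμ r⁻¹ (inv_pos.2 hr)).mul_right _).hasSum fun n => ?_
    rw [norm_mul, Complex.norm_real, Real.norm_eq_abs]
    exact (mul_le_mul_of_nonneg_left (hc' n) (abs_nonneg _)).trans_eq (by ring)
  refine continuous_of_continuousAt_zero ((coeffSeries hc μ hμ).comp (ofHolFun W hW)) ?_
  rw [ContinuousAt, map_zero]
  refine squeeze_zero_norm hbound ?_
  have hcont : Continuous fun F : HolFun W =>
      (∑' n, |μ n| * r⁻¹ ^ n) * ‖(F : C(W, ℂ)).restrict S‖ :=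
    continuous_const.mul (((ContinuousMap.continuous_restrict S).comp continuous_subtype_val).norm)
  refine (hcont.tendsto 0).trans_eq ?_
  have h0 : ((0 : HolFun W) : C(W, ℂ)).restrict S = 0 := rfl
  rw [h0, norm_zero, mul_zero]

end HolGerm

/-! ### Analyticity of the functions of two variables associated with analytic curves -/

namespace RealAnalyticFun

/-- The Taylor coefficients of a real analytic function. -/
noncomputable def taylorCoeff (t₀ : ℝ) (n : ℕ) (h : RealAnalyticFun) : ℝ :=
  (HolGerm.coeff (A := realAxis) ⟨t₀, rfl⟩ n (toHolGerm h)).re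

theorem exists_taylorCoeff_bound (t₀ : ℝ) (h : RealAnalyticFun) :
    ∃ C k : ℝ, 0 < k ∧ ∀ n, |taylorCoeff t₀ n h| ≤ C * k ^ n := by
  obtain ⟨C, k, hk, hb⟩ := HolGerm.exists_coeff_bound (A := realAxis) ⟨t₀, rfl⟩ (toHolGerm h)
  exact ⟨C, k, hk, fun n => (Complex.abs_re_le_norm _).trans (hb n)⟩

theorem eventually_hasSum_taylorCoeff (t₀ : ℝ) (h : RealAnalyticFun) :
    ∀ᶠ t in 𝓝 t₀, HasSum (fun n => taylorCoeff t₀ n h * (t - t₀) ^ n) (h t) := by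
  obtain ⟨W, g, hW, hg, hgh⟩ := exists_holomorphic_extension h.analytic
  have hsum := (hg.analyticAt (W.isOpen.mem_nhds (hW ⟨t₀, rfl⟩))).eventually_hasSum_iteratedDeriv
  filter_upwards [Complex.continuous_ofReal.continuousAt.eventually hsum] with t ht
  have := Complex.hasSum_re ht
  rw [hgh, Complex.ofReal_re] at this
  refine this.congr_fun fun n => ?_
  have hcoeff : HolGerm.coeff (A := realAxis) ⟨t₀, rfl⟩ n (toHolGerm h) =
      iteratedDeriv n g t₀ / n.factorial :=
    HolGerm.coeff_eq _ n (extensionGerm_val_eq h hW hg hgh)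
  rw [taylorCoeff, hcoeff, ← Complex.ofReal_sub, ← Complex.ofReal_pow, Complex.re_mul_ofReal]

/-- The functional given by a superexponentially decreasing combination of Taylor coefficients. -/
noncomputable def taylorSeriesFunctional (t₀ : ℝ) (μ : ℕ → ℝ)
    (hμ : ∀ R > 0, Summable fun n => |μ n| * R ^ n) : RealAnalyticFun →L[ℝ] ℝ where
  toLinearMap := Complex.reLm ∘ₗ
    (HolGerm.coeffSeries (A := realAxis) ⟨t₀, rfl⟩ μ hμ).restrictScalars ℝ ∘ₗ toHolGerm
  cont := Complex.continuous_re.comp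
    ((HolGerm.continuous_coeffSeries _ μ hμ).comp continuous_induced_dom)

theorem taylorSeriesFunctional_apply (t₀ : ℝ) (μ : ℕ → ℝ)
    (hμ : ∀ R > 0, Summable fun n => |μ n| * R ^ n) (h : RealAnalyticFun) :
    taylorSeriesFunctional t₀ μ hμ h = ∑' n, μ n * taylorCoeff t₀ n h := by
  have := Complex.hasSum_re (HolGerm.summable_mul_coeff (A := realAxis) ⟨t₀, rfl⟩ hμ
    (toHolGerm h)).hasSum
  refine this.tsum_eq.symm.trans (tsum_congr fun n => ?_)
  rw [Complex.re_ofReal_mul]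
  rfl

end RealAnalyticFun

open RealAnalyticFun in
theorem IsRealAnalyticCurve.analyticOnNhd_uncurry {f : ℝ → RealAnalyticFun}
    (hf : IsRealAnalyticCurve f) : AnalyticOnNhd ℝ (fun p : ℝ × ℝ => f p.1 p.2) univ := by
  rintro ⟨s₀, t₀⟩ -
  have han : ∀ μ : ℕ → ℝ, (∀ R > 0, Summable fun n => |μ n| * R ^ n) →
      AnalyticOnNhd ℝ (fun s => ∑' n, μ n * taylorCoeff t₀ n (f s)) univ := by
    intro μ hμ
    simpa only [taylorSeriesFunctional_apply] using hf (taylorSeriesFunctional t₀ μ hμ)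
  have hA : ∀ n, AnalyticOnNhd ℝ (fun s => taylorCoeff t₀ n (f s)) univ := by
    intro n
    -- A weight supported at `n` isolates the `n`-th coefficient.
    have := han (Pi.single n 1) fun R _ => summable_of_ne_finset_zero (s := {n}) fun i hi => by
      rw [Pi.single_eq_of_ne (by simpa using hi), abs_zero, zero_mul]
    convert this using 2 with s
    rw [tsum_eq_single n fun i hi => by rw [Pi.single_eq_of_ne hi, zero_mul], Pi.single_eq_same,
      one_mul]
  obtain ⟨C, k, hk, hb⟩ := exists_iteratedDeriv_bound_of_weighted
    (fun n s => taylorCoeff t₀ n (f s)) (fun s => exists_taylorCoeff_bound t₀ (f s)) han s₀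
  exact analyticAt_prod_of_iteratedDeriv_bound hk (fun s => (f s).analytic) hA
    (fun s => eventually_hasSum_taylorCoeff t₀ (f s)) hb

theorem mainTheorem6 :
    BijOn (fun (f : ℝ → RealAnalyticFun) (p : ℝ × ℝ) => f p.1 p.2)
      {f : ℝ → RealAnalyticFun | IsRealAnalyticCurve f}
      {g : ℝ × ℝ → ℝ | AnalyticOnNhd ℝ g univ} := by
  refine ⟨fun f hf => hf.analyticOnNhd_uncurry, fun f₁ _ f₂ _ h => ?_, fun g hg => ?_⟩
  · funext s
    refine DFunLike.coe_injective (funext fun t => ?_)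
    exact congrFun h (s, t)
  · let f : ℝ → RealAnalyticFun := fun s => ⟨fun t => g (s, t), fun t _ =>
      (hg (s, t) (mem_univ _)).comp_of_eq (analyticAt_const.prod analyticAt_id) rfl⟩
    exact ⟨f, isRealAnalyticCurve_of_analyticOnNhd f hg, rfl⟩
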